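/- **Setting.** Fix $n$ levels of similarity and the first-order vocabulary with unary predicates $\mathrm{Copy}$, $\mathrm{Access}$, $\mathrm{Similar}_1,\dots,\mathrm{Similar}_n$, $\epsilon\text{-}\mathrm{NAF}$, a binary predicate $\mathrm{Generated}$, and constants $\tilde x$ (the defendant's work) and $M$ (the generative model). Let $\gamma:(0,\infty)\to(1,\infty)$ be increasing (possibly not strictly), let $\epsilon>0$, $\delta\in[0,1]$ and $0\le\alpha'_1\le\dots\le\alpha'_n\le 1$, and put $$\Gamma(\epsilon,\delta)=\frac{\gamma(\epsilon)\,\delta}{1+\delta(\gamma(\epsilon)-1)}.$$ Write $S_i(x)=\mathrm{Similar}_i(x)\wedge\bigwedge_{k>i}\neg\mathrm{Similar}_k(x)$. Let $\mathrm{KB}_{\mathrm{naf}}$ be the conjunction of 1. $\forall x\,(\mathrm{Copy}(x)\Rightarrow\mathrm{Access}(x))$; 2. $\forall x\,(\mathrm{Similar}_{i+1}(x)\Rightarrow\mathrm{Similar}_i(x))$ for $1\le i<n$; 3. $\lVert \mathrm{Copy}(x)\mid \mathrm{Access}(x)\wedge S_i(x)\wedge\mathrm{Generated}(x,M)\rVert_x\approx\alpha'_i$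 for $1\le i\le n$; 4. $\lVert \mathrm{Access}(x)\mid S_i(x)\wedge\mathrm{Generated}(x,M)\wedge\epsilon\text{-}\mathrm{NAF}(M)\rVert_x\preceq\Gamma(\epsilon,\delta)$ for $1\le i\le n$; 5. $\lVert \mathrm{Access}(x)\mid \mathrm{Generated}(x,M)\wedge\epsilon\text{-}\mathrm{NAF}(M)\rVert_x\approx\delta$; and let $\mathrm{KB}_i=S_i(\tilde x)\wedge\mathrm{Generated}(\tilde x,M)\wedge\epsilon\text{-}\mathrm{NAF}(M)$. Each sign $\approx$, $\preceq$ carries its own tolerance, a component of a vector $\vec\tau$ of positive reals: $\lVert P\mid Q\rVert_x\approx a$ with tolerance $t$ means $\bigl|\lVert P\wedge Q\rVert_x-a\lVert Q\rVert_x\bigr|\le t\lVert Q\rVert_x$, and $\lVert P\mid Q\rVert_x\preceq a$ means $\lVert P\wedge Q\rVert_x-a\lVert Q\rVert_x\le t\lVert Q\rVert_x$, where $\lVert P\rVert_x$ is the proportion of domain elements satisfying $P$. For a domain of size $N$, $\mathrm{Pr}^{\vec\tau}_N(\varphi\mid\mathrm{KB})$ is the fraction of the worlds (interpretations of the vocabulary)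 satisfying $\mathrm{KB}$ that also satisfy $\varphi$. The degree of belief $\mathrm{Pr}_\infty(\varphi\mid\mathrm{KB})$ exists and equals $p$ if, for all sufficiently small $\vec\tau$ and all sufficiently large $N$, some world satisfies $\mathrm{KB}$, and $\lim_{\vec\tau\to0}\liminf_{N\to\infty}\mathrm{Pr}^{\vec\tau}_N(\varphi\mid\mathrm{KB})=\lim_{\vec\tau\to0}\limsup_{N\to\infty}\mathrm{Pr}^{\vec\tau}_N(\varphi\mid\mathrm{KB})=p$. **Proposition.** For every $i$, if the degree of belief exists, then $$\mathrm{Pr}_\infty(\mathrm{Copy}(\tilde x)\mid\mathrm{KB}_{\mathrm{naf}}\wedge\mathrm{KB}_i)\le\alpha'_i\,\Gamma(\epsilon,\delta).$$ The bound $\alpha'_i\Gamma(\epsilon,\delta)$ is nondecreasing in $\epsilon>0$, and strictly increasing if $\gamma$ is strictly increasing, $\alpha'_i>0$ and $0<\delta<1$. Moreover, $\Gamma(\epsilon,\cdot)$ is strictly increasing on $[0,1]$, and $\delta\le\Gamma(\epsilon,\delta)$ for all $\delta\in[0,1]$, with equality if and only if $\delta=0$ or $\delta=1$. -/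

import Mathlib

open Filter Topology Set

namespace RandomWorlds

/-- A tolerance vector assigns to each approximate (in)equality sign of the language
(indexed by `T`) a positive real number. This is the filter of tolerance vectors tending to `0`. -/
def tolerancesToZero (T : Type) : Filter (T → ℝ) :=
  𝓝[{τ : T → ℝ | ∀ t, 0 < τ t}] 0

/-- A sentence of the language of approximate proportions over a vocabulary with tolerance
indices `T`, given by its meaning: for each tolerance vector `τ` and each domain size `N`, the
set of worlds of size `N` in which it holds. `W N` is the type of all worlds of size `N`. -/
abbrev Sentence (T : Type) (W : ℕ → Type) : Type :=
  (T → ℝ) → (N : ℕ) → W N → Prop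

/-- Conjunction of two sentences. -/
def Sentence.and {T : Type} {W : ℕ → Type} (φ ψ : Sentence T W) : Sentence T W :=
  fun τ N w => φ τ N w ∧ ψ τ N w

/-- The number of worlds of size `N` that satisfy `φ` with tolerances `τ`. -/
noncomputable def numWorlds {T : Type} {W : ℕ → Type} (φ : Sentence T W) (τ : T → ℝ) (N : ℕ) :
    ℕ :=
  Nat.card {w : W N // φ τ N w}

/-- `Pr_N^τ(φ | KB)`: the fraction of the worlds of size `N` satisfying `KB` that also
satisfy `φ`. -/
noncomputable def pr {T : Type} {W : ℕ → Type} (φ KB : Sentence T W) (τ : T → ℝ) (N : ℕ) : ℝ :=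
  (numWorlds (φ.and KB) τ N : ℝ) / (numWorlds KB τ N : ℝ)

/-- `KB` is eventually consistent: for all sufficiently small tolerance vectors and all
sufficiently large domain sizes, some world satisfies it. -/
def EventuallyConsistent {T : Type} {W : ℕ → Type} (KB : Sentence T W) : Prop :=
  ∀ᶠ τ in tolerancesToZero T, ∀ᶠ N in atTop, 0 < numWorlds KB τ N

/-- The degree of belief `Pr_∞(φ | KB)` exists and equals `p`: `KB` is eventually consistent, and
the limits, as `τ → 0`, of both the lower and the upper limit of `Pr_N^τ(φ | KB)` as `N → ∞`
exist and equal `p`. -/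
def HasDegreeOfBelief {T : Type} {W : ℕ → Type} (φ KB : Sentence T W) (p : ℝ) : Prop :=
  EventuallyConsistent KB ∧
  Tendsto (fun τ => liminf (fun N => pr φ KB τ N) atTop) (tolerancesToZero T) (𝓝 p) ∧
  Tendsto (fun τ => limsup (fun N => pr φ KB τ N) atTop) (tolerancesToZero T) (𝓝 p)

/-- The proportion `‖P(x)‖_x` of elements of a domain of size `N` that satisfy `P`. -/
noncomputable def proportion {N : ℕ} (P : Fin N → Prop) : ℝ :=
  (Nat.card {x : Fin N // P x} : ℝ) / (N : ℝ)

/-- `‖P(x) | Q(x)‖_x ≈ a` with tolerance `t`. As usual for the random-worlds method, the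
conditional proportion is multiplied out, so that the condition is vacuous if nothing
satisfies `Q`. -/
def CondApprox {N : ℕ} (P Q : Fin N → Prop) (a t : ℝ) : Prop :=
  |proportion (fun x => P x ∧ Q x) - a * proportion Q| ≤ t * proportion Q

/-- `‖P(x) | Q(x)‖_x ≼ a` with tolerance `t`. -/
def CondApproxLE {N : ℕ} (P Q : Fin N → Prop) (a t : ℝ) : Prop :=
  proportion (fun x => P x ∧ Q x) - a * proportion Q ≤ t * proportion Q

end RandomWorlds

namespace Copyright

open RandomWorlds

/-- A world with domain `{0, …, N - 1}`: an interpretation of the vocabulary consisting of the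
unary predicates `Copy`, `Access`, `Similar_i` (for the `n` levels of similarity) and `ε-NAF`, of
the binary predicate `Generated`, and of the constants for the defendant's work and for the
generative model `M`. -/
structure World (n N : ℕ) where
  copy : Fin N → Prop
  access : Fin N → Prop
  similar : Fin n → Fin N → Prop
  generated : Fin N → Fin N → Prop
  naf : Fin N → Prop
  work : Fin N
  model : Fin N

/-- There are finitely many worlds of each size. -/
instance World.instFinite (n N : ℕ) : Finite (World n N) := by
  refine Finite.of_injective
    (fun w : World n N =>
      (w.copy, w.access, w.similar, w.generated, w.naf, w.work, w.model)) ?_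
  rintro ⟨_, _, _, _, _, _, _⟩ ⟨_, _, _, _, _, _, _⟩ h
  simp only [Prod.mk.injEq] at h
  obtain ⟨rfl, rfl, rfl, rfl, rfl, rfl, rfl⟩ := h
  rfl

/-- `x` has maximal level of similarity `i`: `Similar_i(x) ∧ ⋀_{k > i} ¬ Similar_k(x)`. -/
def World.MaxSimilar {n N : ℕ} (w : World n N) (i : Fin n) (x : Fin N) : Prop :=
  w.similar i x ∧ ∀ k : Fin n, i < k → ¬ w.similar k x

/-- The indices of the tolerances: one for each approximate (in)equality sign in the
knowledge base. -/
inductive Tol (n : ℕ) : Type where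
  | copyGivenAccess (i : Fin n) : Tol n
  | accessGivenSimilar (i : Fin n) : Tol n
  | accessGivenGenerated : Tol n

/-- `Γ(ε, δ) = γ(ε) δ / (1 + δ (γ(ε) - 1))`. -/
noncomputable def Gam (γ : ℝ → ℝ) (ε δ : ℝ) : ℝ :=
  γ ε * δ / (1 + δ * (γ ε - 1))

/-- The knowledge base `KB_naf`. -/
def KBnaf {n : ℕ} (α : Fin n → ℝ) (γ : ℝ → ℝ) (ε δ : ℝ) : Sentence (Tol n) (World n) :=
  fun τ _ w =>
    (∀ x, w.copy x → w.access x) ∧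
    (∀ i j : Fin n, (j : ℕ) = (i : ℕ) + 1 → ∀ x, w.similar j x → w.similar i x) ∧
    (∀ i : Fin n,
      CondApprox w.copy
        (fun x => w.access x ∧ w.MaxSimilar i x ∧ w.generated x w.model)
        (α i) (τ (.copyGivenAccess i))) ∧
    (∀ i : Fin n,
      CondApproxLE w.access
        (fun x => w.MaxSimilar i x ∧ w.generated x w.model ∧ w.naf w.model)
        (Gam γ ε δ) (τ (.accessGivenSimilar i))) ∧
    CondApprox w.access (fun x => w.generated x w.model ∧ w.naf w.model)
      δ (τ .accessGivenGenerated)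

/-- The knowledge base `KB_i`: the defendant's work has maximal level of similarity `i` and was
generated by `M`, which satisfies `ε-NAF`. -/
def KBlevel {n : ℕ} (i : Fin n) : Sentence (Tol n) (World n) :=
  fun _ _ w => w.MaxSimilar i w.work ∧ w.generated w.work w.model ∧ w.naf w.model

/-- The sentence saying that the defendant's work was made by copying. -/
def CopyWork (n : ℕ) : Sentence (Tol n) (World n) :=
  fun _ _ w => w.copy w.work

end Copyright

namespace RandomWorlds

/-! `KBnaf` does not mention the defendant's work. Hence the worlds split into fibres in which only
the work varies, over the whole domain, and `KBnaf` is constant on each fibre. Counting worlds thus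
becomes counting elements inside one world (`card_world_le`). There, copying implies access, so the
two conditional proportions chain: copies number at most `α i + τ` times the accessed elements,
which number at most `Γ + τ'` times all elements of the reference class (`card_copy_le`). Summing
over fibres bounds `pr` at every `N`, and `τ → 0` gives `α i * Γ`. The claims about `Γ` follow from
explicit factorizations. -/

instance tolerancesToZero_neBot (T : Type) : (tolerancesToZero T).NeBot := by
  rw [tolerancesToZero, ← mem_closure_iff_nhdsWithin_neBot]
  have h : {τ : T → ℝ | ∀ t, 0 < τ t} = Set.pi univ fun _ => Ioi 0 := by
    ext τ
    simp
  rw [h, closure_pi_set]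
  intro t _
  simp [closure_Ioi]

theorem tendsto_apply_tolerancesToZero {T : Type} (t : T) :
    Tendsto (fun τ : T → ℝ => τ t) (tolerancesToZero T) (𝓝 0) :=
  ((continuous_apply t).tendsto (0 : T → ℝ)).mono_left nhdsWithin_le_nhds

/-- If the conditional probabilities are bounded by `c τ` at every domain size, then the degree
of belief is bounded by the limit of `c`. -/
theorem HasDegreeOfBelief.le_of_pr_le {T : Type} {W : ℕ → Type} {φ KB : Sentence T W}
    {p q : ℝ} (h : HasDegreeOfBelief φ KB p) {c : (T → ℝ) → ℝ}
    (hc : Tendsto c (tolerancesToZero T) (𝓝 q))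
    (hpr : ∀ τ : T → ℝ, (∀ t, 0 < τ t) → ∀ N, pr φ KB τ N ≤ c τ) : p ≤ q := by
  refine le_of_tendsto_of_tendsto h.2.2 hc ?_
  filter_upwards [self_mem_nhdsWithin] with τ hτ
  refine limsup_le_of_le ?_ (Eventually.of_forall (hpr τ hτ))
  -- A real `limsup` is meaningful only with a bound from below; `pr` is nonnegative, even as `0 / 0
  -- = 0`.
  refine IsCoboundedUnder.of_frequently_ge (a := 0) (Eventually.frequently ?_)
  exact Eventually.of_forall fun N => div_nonneg (Nat.cast_nonneg _) (Nat.cast_nonneg _)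

theorem proportion_mul_card {N : ℕ} (P : Fin N → Prop) :
    proportion P * N = Nat.card {x // P x} := by
  rcases Nat.eq_zero_or_pos N with rfl | hN
  · simp
  · exact div_mul_cancel₀ _ (by positivity)

theorem CondApproxLE.card_le {N : ℕ} {P Q : Fin N → Prop} {a t : ℝ} (h : CondApproxLE P Q a t) :
    (Nat.card {x // P x ∧ Q x} : ℝ) ≤ (a + t) * Nat.card {x // Q x} := by
  rw [← proportion_mul_card, ← proportion_mul_card, ← mul_assoc]
  refine mul_le_mul_of_nonneg_right ?_ (Nat.cast_nonneg N)
  unfold CondApproxLE at h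
  linarith

theorem CondApprox.condApproxLE {N : ℕ} {P Q : Fin N → Prop} {a t : ℝ}
    (h : CondApprox P Q a t) : CondApproxLE P Q a t :=
  (le_abs_self _).trans h

end RandomWorlds

namespace Copyright

open RandomWorlds

/-- A world is an interpretation of the predicates and of the model, together with an
interpretation of the defendant's work. -/
def World.equivProd (n N : ℕ) :
    World n N ≃ ((Fin N → Prop) × (Fin N → Prop) × (Fin n → Fin N → Prop) ×
      (Fin N → Fin N → Prop) × (Fin N → Prop) × Fin N) × Fin N where
  toFun w := ((w.copy, w.access, w.similar, w.generated, w.naf, w.model), w.work)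
  invFun b := ⟨b.1.1, b.1.2.1, b.1.2.2.1, b.1.2.2.2.1, b.1.2.2.2.2.1, b.2, b.1.2.2.2.2.2⟩
  left_inv _ := rfl
  right_inv _ := rfl

/-- To compare numbers of worlds it suffices to compare, in each world, the numbers of ways to
reinterpret the defendant's work. -/
theorem card_world_le {n N : ℕ} {P Q : World n N → Prop} {c : ℝ}
    (h : ∀ w : World n N, (Nat.card {x // P {w with work := x}} : ℝ) ≤
      c * Nat.card {x // Q {w with work := x}}) :
    (Nat.card {w // P w} : ℝ) ≤ c * Nat.card {w // Q w} := by
  have := Fintype.ofFinite ((Fin N → Prop) × (Fin N → Prop) × (Fin n → Fin N → Prop) ×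
    (Fin N → Fin N → Prop) × (Fin N → Prop) × Fin N)
  have key (R : World n N → Prop) : (Nat.card {w // R w} : ℝ) =
      ∑ b, (Nat.card {x // R ((World.equivProd n N).symm (b, x))} : ℝ) := by
    rw [← Nat.cast_sum, ← Nat.card_sigma]
    congr 1
    refine Nat.card_congr (((World.equivProd n N).symm.subtypeEquiv fun b => Iff.rfl).symm.trans ?_)
    exact Equiv.subtypeProdEquivSigmaSubtype
      fun b x => R ((World.equivProd n N).symm (b, x))
  rw [key P, key Q, Finset.mul_sum]
  exact Finset.sum_le_sum fun b _ => h ((World.equivProd n N).symm (b, b.2.2.2.2.2))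

theorem one_le_denom {g δ : ℝ} (hg : 1 < g) (hδ : 0 ≤ δ) : 1 ≤ 1 + δ * (g - 1) :=
  le_add_of_nonneg_right (mul_nonneg hδ (sub_nonneg.2 hg.le))

theorem Gam_nonneg {γ : ℝ → ℝ} {ε δ : ℝ} (hg : 1 < γ ε) (hδ : 0 ≤ δ) : 0 ≤ Gam γ ε δ :=
  div_nonneg (mul_nonneg (by linarith) hδ) (by linarith [one_le_denom hg hδ])

theorem card_copy_le {n : ℕ} {α : Fin n → ℝ} {γ : ℝ → ℝ} {ε δ : ℝ} {τ : Tol n → ℝ} {N : ℕ}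
    {w : World n N} (hw : KBnaf α γ ε δ τ N w) (i : Fin n)
    (hc : 0 ≤ α i + τ (.copyGivenAccess i)) :
    (Nat.card {x // w.copy x ∧ w.MaxSimilar i x ∧ w.generated x w.model ∧ w.naf w.model} : ℝ) ≤
      (α i + τ (.copyGivenAccess i)) * (Gam γ ε δ + τ (.accessGivenSimilar i)) *
        Nat.card {x // w.MaxSimilar i x ∧ w.generated x w.model ∧ w.naf w.model} := by
  obtain ⟨hca, -, hcopy, hacc, -⟩ := hw
  -- `naf w.model` does not depend on `x`: if true, it drops out and the two conditions chain; if
  -- false, both counts vanish.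
  by_cases hm : w.naf w.model
  · have h₁ := (hcopy i).condApproxLE.card_le
    have h₂ := (hacc i).card_le
    have e (x : Fin N) : w.copy x ∧ w.access x ∧ w.MaxSimilar i x ∧ w.generated x w.model ↔
        w.copy x ∧ w.MaxSimilar i x ∧ w.generated x w.model :=
      ⟨fun h => ⟨h.1, h.2.2⟩, fun h => ⟨h.1, hca x h.1, h.2⟩⟩
    simp only [e] at h₁
    simp only [hm, and_true] at h₂ ⊢
    rw [mul_assoc]
    exact h₁.trans (mul_le_mul_of_nonneg_left h₂ hc)
  · simp [hm]

theorem pr_copyWork_le {n : ℕ} {α : Fin n → ℝ} {γ : ℝ → ℝ} {ε δ : ℝ} {τ : Tol n → ℝ}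
    (hτ : ∀ t, 0 < τ t) (i : Fin n) (hα : 0 ≤ α i) (hg : 1 < γ ε) (hδ : 0 ≤ δ) (N : ℕ) :
    pr (CopyWork n) ((KBnaf α γ ε δ).and (KBlevel i)) τ N ≤
      (α i + τ (.copyGivenAccess i)) * (Gam γ ε δ + τ (.accessGivenSimilar i)) := by
  have hc : 0 ≤ α i + τ (.copyGivenAccess i) := add_nonneg hα (hτ _).le
  have hc' : 0 ≤ Gam γ ε δ + τ (.accessGivenSimilar i) := add_nonneg (Gam_nonneg hg hδ) (hτ _).le
  -- This also covers a zero denominator, so consistency is not needed.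
  refine div_le_of_le_mul₀ (Nat.cast_nonneg _) (mul_nonneg hc hc') (card_world_le fun w => ?_)
  by_cases hw : KBnaf α γ ε δ τ N w
  · have hw' (x : Fin N) : KBnaf α γ ε δ τ N {w with work := x} := hw
    simp only [Sentence.and, hw', true_and]
    exact card_copy_le hw i hc
  · have hw' (x : Fin N) : ¬ KBnaf α γ ε δ τ N {w with work := x} := hw
    simp [Sentence.and, hw']

theorem degreeOfBelief_copyWork_le {n : ℕ} {α : Fin n → ℝ} {γ : ℝ → ℝ} {ε δ : ℝ} {i : Fin n}
    {p : ℝ} (hα : 0 ≤ α i) (hg : 1 < γ ε) (hδ : 0 ≤ δ)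
    (h : HasDegreeOfBelief (CopyWork n) ((KBnaf α γ ε δ).and (KBlevel i)) p) :
    p ≤ α i * Gam γ ε δ := by
  refine h.le_of_pr_le ?_ fun τ hτ N => pr_copyWork_le hτ i hα hg hδ N
  simpa using ((tendsto_apply_tolerancesToZero (Tol.copyGivenAccess i)).const_add (α i)).mul
    ((tendsto_apply_tolerancesToZero (Tol.accessGivenSimilar i)).const_add (Gam γ ε δ))

theorem Gam_le_Gam_of_le {γ : ℝ → ℝ} {ε ε' δ : ℝ} (hg : 1 < γ ε) (hg' : 1 < γ ε')
    (h : γ ε ≤ γ ε') (hδ : δ ∈ Icc (0 : ℝ) 1) : Gam γ ε δ ≤ Gam γ ε' δ := by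
  have h₁ := one_le_denom hg hδ.1
  have h₂ := one_le_denom hg' hδ.1
  rw [Gam, Gam, div_le_div_iff₀ (by linarith) (by linarith)]
  -- The cross products differ by exactly `δ * (1 - δ) * (γ ε' - γ ε)`.
  linarith [mul_nonneg (mul_nonneg hδ.1 (sub_nonneg.2 hδ.2)) (sub_nonneg.2 h)]

theorem Gam_lt_Gam_of_lt {γ : ℝ → ℝ} {ε ε' δ : ℝ} (hg : 1 < γ ε) (hg' : 1 < γ ε')
    (h : γ ε < γ ε') (hδ : 0 < δ) (hδ' : δ < 1) : Gam γ ε δ < Gam γ ε' δ := by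
  have h₁ := one_le_denom hg hδ.le
  have h₂ := one_le_denom hg' hδ.le
  rw [Gam, Gam, div_lt_div_iff₀ (by linarith) (by linarith)]
  linarith [mul_pos (mul_pos hδ (sub_pos.2 hδ')) (sub_pos.2 h)]

theorem strictMonoOn_Gam {γ : ℝ → ℝ} {ε : ℝ} (hg : 1 < γ ε) :
    StrictMonoOn (fun δ => Gam γ ε δ) (Icc 0 1) := by
  intro a ha b hb hab
  have h₁ := one_le_denom hg ha.1
  have h₂ := one_le_denom hg hb.1
  simp only [Gam]
  rw [div_lt_div_iff₀ (by linarith) (by linarith)]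
  -- Here the cross products differ by `γ ε * (b - a)`.
  linarith [mul_pos (zero_lt_one.trans hg) (sub_pos.2 hab)]

/-- The factored form yields both the inequality `δ ≤ Γ` and its equality cases. -/
theorem Gam_sub_self {γ : ℝ → ℝ} {ε δ : ℝ} (hg : 1 < γ ε) (hδ : 0 ≤ δ) :
    Gam γ ε δ - δ = δ * (1 - δ) * (γ ε - 1) / (1 + δ * (γ ε - 1)) := by
  have h := one_le_denom hg hδ
  rw [Gam, eq_div_iff (by linarith), sub_mul, div_mul_cancel₀ _ (by linarith)]
  ring

theorem self_le_Gam {γ : ℝ → ℝ} {ε δ : ℝ} (hg : 1 < γ ε) (hδ : δ ∈ Icc (0 : ℝ) 1) :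
    δ ≤ Gam γ ε δ := by
  rw [← sub_nonneg, Gam_sub_self hg hδ.1]
  exact div_nonneg (mul_nonneg (mul_nonneg hδ.1 (sub_nonneg.2 hδ.2)) (sub_nonneg.2 hg.le))
    (zero_le_one.trans (one_le_denom hg hδ.1))

theorem Gam_eq_self_iff {γ : ℝ → ℝ} {ε δ : ℝ} (hg : 1 < γ ε) (hδ : 0 ≤ δ) :
    Gam γ ε δ = δ ↔ δ = 0 ∨ δ = 1 := by
  have h := one_le_denom hg hδ
  rw [← sub_eq_zero, Gam_sub_self hg hδ, div_eq_zero_iff, mul_eq_zero, mul_eq_zero,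
    or_iff_left (by linarith), or_iff_left (sub_ne_zero.2 hg.ne'), sub_eq_zero, eq_comm (a := 1)]

end Copyright

open RandomWorlds Copyright in
theorem proposition2 (n : ℕ) (α : Fin n → ℝ) (hα : ∀ i, α i ∈ Set.Icc (0 : ℝ) 1)
    (hα_mono : Monotone α) (γ : ℝ → ℝ) (hγ : ∀ ε, 0 < ε → 1 < γ ε)
    (hγ_mono : MonotoneOn γ (Set.Ioi 0)) :
    -- the degree of belief in copying is at most `α i * Γ(ε, δ)`
    (∀ ε δ : ℝ, 0 < ε → δ ∈ Set.Icc (0 : ℝ) 1 → ∀ i : Fin n, ∀ p : ℝ,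
      HasDegreeOfBelief (CopyWork n) ((KBnaf α γ ε δ).and (KBlevel i)) p →
        p ≤ α i * Gam γ ε δ) ∧
    -- the bound is increasing in `ε`
    (∀ δ ∈ Set.Icc (0 : ℝ) 1, ∀ i : Fin n,
      MonotoneOn (fun ε => α i * Gam γ ε δ) (Set.Ioi 0) ∧
      (StrictMonoOn γ (Set.Ioi 0) → 0 < α i → 0 < δ → δ < 1 →
        StrictMonoOn (fun ε => α i * Gam γ ε δ) (Set.Ioi 0))) ∧
    -- `Γ` is increasing in `δ`, and at least `δ`, with equality only at the end points
    (∀ ε : ℝ, 0 < ε →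
      StrictMonoOn (fun δ => Gam γ ε δ) (Set.Icc 0 1) ∧
      ∀ δ ∈ Set.Icc (0 : ℝ) 1,
        δ ≤ Gam γ ε δ ∧ (Gam γ ε δ = δ ↔ δ = 0 ∨ δ = 1)) := by
  refine ⟨fun ε δ hε hδ i p h => degreeOfBelief_copyWork_le (hα i).1 (hγ ε hε) hδ.1 h,
    fun δ hδ i => ⟨fun a ha b hb hab => ?_, fun hs hi h₀ h₁ a ha b hb hab => ?_⟩,
    fun ε hε => ⟨strictMonoOn_Gam (hγ ε hε), fun δ hδ =>
      ⟨self_le_Gam (hγ ε hε) hδ, Gam_eq_self_iff (hγ ε hε) hδ.1⟩⟩⟩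
  · exact mul_le_mul_of_nonneg_left
      (Gam_le_Gam_of_le (hγ a ha) (hγ b hb) (hγ_mono ha hb hab) hδ) (hα i).1
  · exact mul_lt_mul_of_pos_left
      (Gam_lt_Gam_of_lt (hγ a ha) (hγ b hb) (hs ha hb hab) h₀ h₁) hi
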